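/- Let $G$ be a connected complex linear algebraic group, $V$ a finite-dimensional complex vector space and $\rho:G\to \mathrm{GL}(V)$ a rational representation having a Zariski open orbit $\Omega\subset V$, i.e. $(G,\rho,V)$ is a prehomogeneous vector space. A rational function $f$ on $V$, not identically zero, is called a relative invariant if there is a rational character $\chi:G\to\mathbb{C}^*$ with $f(\rho(g)(v))=\chi(g)f(v)$ for all $g\in G$, $v\in\Omega$. A rational function $h$ on $V$ is called an additive relative invariant if there is a homomorphism of algebraic groups $\Phi:G\to(\mathbb{C},+)$ with $h(\rho(g)(v))-h(v)=\Phi(g)$ for all $g\in G$, $v\in\Omega$. (These equations are required wherever both sides are defined.) Let $h$ be an additive relative invariant that is not the zero function. Then $h$ is homogeneous of degree $0$, that is, $h(tv)=h(v)$ for every $t\in\mathbb{C}^*$ and every $v\in V$ at which $h$ is defined. Moreover, $h$ may be written as $h=\frac{h_1}{f_1}$, where $h_1$ and $f_1$ are homogeneous polynomials on $V$ with $\deg(h_1)=\deg(f_1)$, $h_1$ and $f_1$ have no common factors, and $f_1$ is a relative invariant. -/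

import Mathlib

noncomputable section

namespace Prehomogeneous

open MvPolynomial Topology

/-! ### Zariski topologies -/

/-- The Zariski topology on the affine space `σ → ℂ`: the closed sets are the common zero sets
of sets of polynomials. -/
@[reducible]
def zariskiAffine (σ : Type*) : TopologicalSpace (σ → ℂ) :=
  TopologicalSpace.ofClosed
    {Z | ∃ S : Set (MvPolynomial σ ℂ), Z = {x | ∀ p ∈ S, eval x p = 0}}
    ⟨{1}, by ext x; simp⟩
    (by
      intro A hA
      refine ⟨{p | ∃ Z ∈ A, ∀ x ∈ Z, eval x p = 0}, ?_⟩
      ext x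
      constructor
      · rintro hx p ⟨Z, hZ, hp⟩
        exact hp x (hx Z hZ)
      · intro hx Z hZ
        obtain ⟨S, rfl⟩ := hA hZ
        intro p hp
        exact hx p ⟨_, hZ, fun y hy => hy p hp⟩)
    (by
      rintro _ ⟨S, rfl⟩ _ ⟨T, rfl⟩
      refine ⟨{r | ∃ p ∈ S, ∃ q ∈ T, r = p * q}, ?_⟩
      ext x
      constructor
      · rintro (hx | hx) _ ⟨p, hp, q, hq, rfl⟩
        · simp [hx p hp]
        · simp [hx q hq]
      · intro hx
        by_contra hcon
        simp only [Set.mem_union, Set.mem_ofPred_eq, not_or, not_forall] at hcon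
        obtain ⟨⟨p, hp, hpx⟩, q, hq, hqx⟩ := hcon
        have := hx _ ⟨p, hp, q, hq, rfl⟩
        rw [map_mul] at this
        exact (mul_ne_zero hpx hqx) this)

/-- The vector of matrix entries of an element of `GL_n(ℂ)`. -/
def entries {n : ℕ} (g : GL (Fin n) ℂ) : Fin n × Fin n → ℂ :=
  fun ij => (g : Matrix (Fin n) (Fin n) ℂ) ij.1 ij.2

/-- The Zariski topology on `GL_n(ℂ)`, a principal open subset of the affine space of
`n × n` matrices. -/
@[reducible]
def zariskiGL (n : ℕ) : TopologicalSpace (GL (Fin n) ℂ) :=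
  (zariskiAffine (Fin n × Fin n)).induced entries

/-- The Zariski topology on a finite-dimensional complex vector space, in the coordinates given
by a basis (it does not depend on the basis). -/
@[reducible]
def zariskiSpace {ι V : Type*} [Finite ι] [AddCommGroup V] [Module ℂ V]
    (b : Module.Basis ι ℂ V) : TopologicalSpace V :=
  (zariskiAffine ι).induced b.equivFun

/-! ### Linear algebraic groups, their characters, additive functions and representations -/

section Groups

variable {n : ℕ}

/-- A subgroup of `GL_n(ℂ)` is a connected complex linear algebraic group if it is Zariski closed
in `GL_n(ℂ)` and connected in the Zariski topology. -/
structure IsConnectedLinearAlgebraicGroup (G : Subgroup (GL (Fin n) ℂ)) : Prop where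
  isClosed : IsClosed[zariskiGL n] (G : Set (GL (Fin n) ℂ))
  isConnected : @IsConnected _ (zariskiGL n) (G : Set (GL (Fin n) ℂ))

/-- Regular functions on a closed subgroup `G` of `GL_n(ℂ)`: restrictions to `G` of polynomials
in the matrix entries divided by a power of the determinant. -/
def IsRegular (G : Subgroup (GL (Fin n) ℂ)) (φ : G → ℂ) : Prop :=
  ∃ (P : MvPolynomial (Fin n × Fin n) ℂ) (k : ℕ), ∀ g : G,
    φ g = eval (entries (g : GL (Fin n) ℂ)) P /
      (((g : GL (Fin n) ℂ) : Matrix (Fin n) (Fin n) ℂ).det) ^ k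

/-- Rational characters of `G`: homomorphisms of algebraic groups `G → 𝔾ₘ`. -/
def IsRationalCharacter (G : Subgroup (GL (Fin n) ℂ)) (χ : G →* ℂˣ) : Prop :=
  IsRegular G fun g => (χ g : ℂ)

/-- Additive functions of `G`: homomorphisms of algebraic groups `G → 𝔾ₐ`. -/
structure IsAdditiveFunction (G : Subgroup (GL (Fin n) ℂ)) (Φ : G → ℂ) : Prop where
  regular : IsRegular G Φ
  map_mul : ∀ g k : G, Φ (g * k) = Φ g + Φ k

/-- A representation of `G` is rational if all its matrix coefficients are regular functions. -/
def IsRationalRep {V : Type*} [AddCommGroup V] [Module ℂ V]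
    (G : Subgroup (GL (Fin n) ℂ)) (ρ : Representation ℂ G V) : Prop :=
  ∀ (ξ : Module.Dual ℂ V) (v : V), IsRegular G fun g => ξ (ρ g v)

end Groups

/-! ### Prehomogeneous vector spaces and relative invariants -/

section Spaces

variable {n : ℕ} {ι V : Type*} [Finite ι] [AddCommGroup V] [Module ℂ V]

/-- `(G, ρ, V)` is a prehomogeneous vector space with open orbit `Ω`. -/
structure IsPrehomogeneous (G : Subgroup (GL (Fin n) ℂ)) (ρ : Representation ℂ G V)
    (b : Module.Basis ι ℂ V) (Ω : Set V) : Prop where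
  group : IsConnectedLinearAlgebraicGroup G
  rational : IsRationalRep G ρ
  isOpen : IsOpen[zariskiSpace b] Ω
  isOrbit : ∃ v₀ : V, Ω = Set.range fun g : G => ρ g v₀

/-- The field of rational functions on a complex vector space with linear coordinates indexed
by `ι`. -/
abbrev RatFun (ι : Type*) : Type _ := FractionRing (MvPolynomial ι ℂ)

/-- The rational function `h` on `V` is defined at `v`, with value `c`: it can be written as `p / q`
with `q v ≠ 0`, and `c = p v / q v`. -/
def HasValueAt (b : Module.Basis ι ℂ V) (h : RatFun ι) (v : V) (c : ℂ) : Prop :=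
  ∃ p q : MvPolynomial ι ℂ, eval (b.equivFun v) q ≠ 0 ∧
    h = algebraMap _ (RatFun ι) p / algebraMap _ (RatFun ι) q ∧
    c = eval (b.equivFun v) p / eval (b.equivFun v) q

/-- Relative invariants: rational functions `f`, not identically zero, with
`f (ρ g v) = χ g * f v` for a rational character `χ`, all `v ∈ Ω` and all `g ∈ G`. The equation
is one between values of rational functions, required wherever both sides are defined. -/
def IsRelativeInvariant (G : Subgroup (GL (Fin n) ℂ)) (ρ : Representation ℂ G V)
    (b : Module.Basis ι ℂ V) (Ω : Set V) (f : RatFun ι) : Prop :=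
  f ≠ 0 ∧ ∃ χ : G →* ℂˣ, IsRationalCharacter G χ ∧
    ∀ v ∈ Ω, ∀ (g : G) (c c' : ℂ), HasValueAt b f v c → HasValueAt b f (ρ g v) c' →
      c' = (χ g : ℂ) * c

/-- Additive relative invariants: rational functions `h` with `h (ρ g v) - h v = Φ g` for an
additive function `Φ` of `G`, all `v ∈ Ω` and all `g ∈ G`. The equation is one between values of
rational functions, required wherever both sides are defined; that `h` has no poles on `Ω`
is a consequence. -/
def IsAdditiveRelativeInvariant (G : Subgroup (GL (Fin n) ℂ)) (ρ : Representation ℂ G V)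
    (b : Module.Basis ι ℂ V) (Ω : Set V) (h : RatFun ι) : Prop :=
  ∃ Φ : G → ℂ, IsAdditiveFunction G Φ ∧
    ∀ v ∈ Ω, ∀ (g : G) (c c' : ℂ), HasValueAt b h v c → HasValueAt b h (ρ g v) c' →
      c' - c = Φ g

/-- A rational function `h` is homogeneous of degree `d` if `h (t v) = t ^ d * h v` for all
nonzero `t` and all `v` where `h` is defined. -/
def IsHomogeneousRat (b : Module.Basis ι ℂ V) (h : RatFun ι) (d : ℤ) : Prop :=
  ∀ (t : ℂ), t ≠ 0 → ∀ (v : V) (c : ℂ), HasValueAt b h v c → HasValueAt b h (t • v) (t ^ d * c)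

end Spaces

end Prehomogeneous

end

/-!
Write `h = p / q` as a reduced fraction. Everything follows from applying one divisibility argument
to two kinds of linear maps, the elements of the group and the dilation by `2`.

Since `Ω` is Zariski dense, the pointwise equation `h (ρ g v) - h v = Φ g` on `Ω` is the polynomial
identity `p ∘ ρ g * q = (p + Φ g * q) * (q ∘ ρ g)` (`pullback_num_mul_den`). Since `ρ g` commutes
with the dilation `v ↦ 2 • v`, the rational function `h (2 • v) - h v` is invariant under `G`, hence
equal to a constant `a` on the orbit `Ω`, and so everywhere; this is an identity of the same shape,
`p ∘ D * q = (p + a * q) * (q ∘ D)` with `D v = 2 • v` (`exists_dilation_identity`).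

An identity of this shape for an invertible linear map `T` forces `q ∣ q ∘ T`, because `q` and
`p + a * q` are relatively prime. As substituting a linear map does not raise the degree,
`q ∘ T = c * q` for a constant `c`, and then `p ∘ T = c * (p + a * q)`
(`exists_pullback_eq_smul_of_isRelPrime`).

* For the dilation by `2`, comparing coefficients shows that `q` is homogeneous of some degree `d`
  with `c = 2 ^ d`, that `a = 0`, and that `p` is homogeneous of degree `d` as well
  (`isHomogeneous_of_pullback_two`).
* For `T = ρ g`, the constant `c = χ g` is a character; it is rational because
  `χ g = q (ρ g v) / q v` for any `v` with `q v ≠ 0`. So `q` is a relative invariant.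
-/

noncomputable section

namespace Prehomogeneous

open MvPolynomial Topology

/-! ### Substituting a linear map into a polynomial -/

section Pullback

variable {ι V : Type*} [Fintype ι] [AddCommGroup V] [Module ℂ V]

lemma eq_of_eval_equivFun_eq (b : Module.Basis ι ℂ V) {p q : MvPolynomial ι ℂ}
    (h : ∀ v, eval (b.equivFun v) p = eval (b.equivFun v) q) : p = q :=
  MvPolynomial.funext fun x => by
    rw [← b.equivFun.apply_symm_apply x]
    exact h _

lemma exists_eval_equivFun_ne_zero (b : Module.Basis ι ℂ V) {p : MvPolynomial ι ℂ} (hp : p ≠ 0) :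
    ∃ v, eval (b.equivFun v) p ≠ 0 := by
  by_contra! h
  exact hp (eq_of_eval_equivFun_eq b (by simpa using h))

variable [DecidableEq ι]

/-- The polynomial `p ∘ T` on `V`, for a polynomial `p` and an endomorphism `T` of `V`, both
written in the coordinates given by the basis `b`. -/
def pullback (b : Module.Basis ι ℂ V) (T : V →ₗ[ℂ] V) :
    MvPolynomial ι ℂ →ₐ[ℂ] MvPolynomial ι ℂ :=
  bind₁ (T.toMvPolynomial b b)

variable (b : Module.Basis ι ℂ V)

@[simp]
lemma eval_pullback (T : V →ₗ[ℂ] V) (p : MvPolynomial ι ℂ) (v : V) :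
    eval (b.equivFun v) (pullback b T p) = eval (b.equivFun (T v)) p := by
  have : (fun i => eval (b.equivFun v) (T.toMvPolynomial b b i)) = b.equivFun (T v) := by
    funext i
    simp [Module.Basis.equivFun_apply, LinearMap.toMvPolynomial_eval_eq_apply]
  rw [← this, pullback, ← MvPolynomial.coe_aeval_eq_eval, RingHom.coe_coe, aeval_bind₁]
  rfl

lemma pullback_ne_zero {T : V →ₗ[ℂ] V} (hT : Function.Surjective T) {p : MvPolynomial ι ℂ}
    (hp : p ≠ 0) : pullback b T p ≠ 0 := by
  intro h
  obtain ⟨v, hv⟩ := exists_eval_equivFun_ne_zero b hp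
  obtain ⟨w, rfl⟩ := hT v
  exact hv (by rw [← eval_pullback, h, map_zero])

lemma totalDegree_pullback_le (T : V →ₗ[ℂ] V) (p : MvPolynomial ι ℂ) :
    (pullback b T p).totalDegree ≤ p.totalDegree := by
  rw [pullback, bind₁, aeval_def, eval₂_eq]
  refine totalDegree_finsetSum_le fun m hm => ?_
  refine (totalDegree_mul _ _).trans ?_
  rw [MvPolynomial.algebraMap_eq, totalDegree_C, zero_add]
  refine (totalDegree_finsetProd _ _).trans ((Finset.sum_le_sum fun i _ => ?_).trans
    (le_totalDegree hm))
  refine (totalDegree_pow _ _).trans ?_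
  simpa using Nat.mul_le_mul_left (m i) (T.toMvPolynomial_totalDegree_le b b i)

lemma weight_one_eq_degree {σ : Type*} (m : σ →₀ ℕ) :
    Finsupp.weight (1 : σ → ℕ) m = m.degree :=
  (DFunLike.congr_fun Finsupp.degree_eq_weight_one m).symm

lemma coeff_pullback_smul_id (t : ℂ) (p : MvPolynomial ι ℂ) (m : ι →₀ ℕ) :
    coeff m (pullback b (t • LinearMap.id) p) = t ^ m.degree * coeff m p := by
  have hX : ∀ i, (t • LinearMap.id : V →ₗ[ℂ] V).toMvPolynomial b b i = C t * X i := fun i =>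
    eq_of_eval_equivFun_eq b fun v => by
      simp [Module.Basis.equivFun_apply, LinearMap.toMvPolynomial_eval_eq_apply]
  induction p using MvPolynomial.induction_on' with
  | add p q hp hq => simp [hp, hq, mul_add]
  | monomial u a =>
    have : pullback b (t • LinearMap.id) (monomial u a) = monomial u (t ^ u.degree * a) := by
      rw [pullback, bind₁_monomial]
      simp only [hX, mul_pow, Finset.prod_mul_distrib, ← C_pow, ← map_prod]
      rw [Finset.prod_pow_eq_pow_sum, ← mul_assoc, ← C_mul, mul_comm a, monomial_eq (s := u)]
      rfl
    rw [this, coeff_monomial, coeff_monomial]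
    split_ifs with h
    · rw [h]
    · simp

end Pullback

/-! ### The divisibility argument -/

section Divisibility

variable {ι V : Type*} [Fintype ι] [DecidableEq ι] [AddCommGroup V] [Module ℂ V]
  (b : Module.Basis ι ℂ V)

/-- If `h = p / q` is a reduced fraction and `h ∘ T = h + a` for an invertible linear map `T`, then
`q` is an eigenvector of the substitution of `T`. -/
lemma exists_pullback_eq_smul_of_isRelPrime {T : V →ₗ[ℂ] V} (hT : Function.Surjective T)
    {p q : MvPolynomial ι ℂ} (hpq : IsRelPrime p q) (hq : q ≠ 0) {a : ℂ}
    (h : pullback b T p * q = (p + C a * q) * pullback b T q) :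
    ∃ c : ℂ, c ≠ 0 ∧ pullback b T q = C c * q ∧ pullback b T p = C c * (p + C a * q) := by
  have hrel : IsRelPrime q (p + C a * q) := by
    have : IsRelPrime q (p + C a * q + (-C a) * q) := by
      rw [neg_mul, add_neg_cancel_right]
      exact hpq.symm
    exact this.of_add_mul_right_right
  obtain ⟨k, hk⟩ := hrel.dvd_of_dvd_mul_left (Dvd.intro_left _ h)
  have hTq := pullback_ne_zero b hT hq
  have hk0 : k ≠ 0 := by rintro rfl; simp [hk] at hTq
  have hdeg := totalDegree_pullback_le b T q
  rw [hk, totalDegree_mul_of_isDomain hq hk0] at hdeg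
  obtain ⟨c, rfl⟩ : ∃ c, k = C c := ⟨_, totalDegree_eq_zero_iff_eq_C.mp (by omega)⟩
  refine ⟨c, fun hc => hk0 (by simp [hc]), by rw [hk, mul_comm], ?_⟩
  refine mul_right_cancel₀ hq ?_
  rw [h, hk]
  ring

/-- If `h = p / q` is a reduced fraction and `h (2 • v) = h v + a`, then `a = 0` and `p` and `q` are
homogeneous of the same degree. -/
lemma isHomogeneous_of_pullback_two {p q : MvPolynomial ι ℂ} (hpq : IsRelPrime p q) (hq : q ≠ 0)
    {a : ℂ} (h : pullback b ((2 : ℂ) • LinearMap.id) p * q =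
      (p + C a * q) * pullback b ((2 : ℂ) • LinearMap.id) q) :
    ∃ d, p.IsHomogeneous d ∧ q.IsHomogeneous d := by
  have hsurj : Function.Surjective ((2 : ℂ) • LinearMap.id : V →ₗ[ℂ] V) := fun v =>
    ⟨(2 : ℂ)⁻¹ • v, by simp⟩
  obtain ⟨c, -, hcq, hcp⟩ := exists_pullback_eq_smul_of_isRelPrime b hsurj hpq hq h
  have hq' : ∀ m, (2 : ℂ) ^ m.degree * coeff m q = c * coeff m q := fun m => by
    rw [← coeff_pullback_smul_id b, hcq, coeff_C_mul]
  have hp' : ∀ m, (2 : ℂ) ^ m.degree * coeff m p = c * (coeff m p + a * coeff m q) := fun m => by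
    rw [← coeff_pullback_smul_id b, hcp, coeff_C_mul, coeff_add, coeff_C_mul]
  have hinj : ∀ {i j : ℕ}, (2 : ℂ) ^ i = 2 ^ j → i = j := fun {i j} hij =>
    Nat.pow_right_injective le_rfl (by exact_mod_cast hij)
  obtain ⟨m₀, hm₀⟩ := ne_zero_iff.mp hq
  obtain rfl : (2 : ℂ) ^ m₀.degree = c := mul_right_cancel₀ hm₀ (hq' m₀)
  -- The term `a * coeff m₀ q` is the only obstruction to equality in degree `m₀.degree`.
  have ha : a = 0 := by
    have h2 : (2 : ℂ) ^ m₀.degree ≠ 0 := pow_ne_zero _ two_ne_zero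
    simpa [hm₀] using mul_left_cancel₀ h2 (hp' m₀)
  refine ⟨m₀.degree, fun m hm => ?_, fun m hm => ?_⟩
  · rw [weight_one_eq_degree]
    exact hinj (mul_right_cancel₀ hm (by simpa [ha] using hp' m))
  · rw [weight_one_eq_degree]
    exact hinj (mul_right_cancel₀ hm (hq' m))

end Divisibility

/-! ### Values of rational functions -/

section Values

variable {ι V : Type*} [Finite ι] [AddCommGroup V] [Module ℂ V] {b : Module.Basis ι ℂ V}

lemma hasValueAt_div (p : MvPolynomial ι ℂ) {q : MvPolynomial ι ℂ} {v : V}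
    (hv : eval (b.equivFun v) q ≠ 0) :
    HasValueAt b (algebraMap _ (RatFun ι) p / algebraMap _ (RatFun ι) q) v
      (eval (b.equivFun v) p / eval (b.equivFun v) q) :=
  ⟨p, q, hv, rfl, rfl⟩

lemma HasValueAt.eq_eval {f : MvPolynomial ι ℂ} {v : V} {c : ℂ}
    (h : HasValueAt b (algebraMap _ (RatFun ι) f) v c) : c = eval (b.equivFun v) f := by
  obtain ⟨p, q, hq, hf, rfl⟩ := h
  have hq0 : algebraMap _ (RatFun ι) q ≠ 0 := fun h0 => hq (by
    rw [(FaithfulSMul.algebraMap_eq_zero_iff _ _).mp h0, map_zero])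
  rw [eq_div_iff hq0, ← map_mul, (FaithfulSMul.algebraMap_injective _ (RatFun ι)).eq_iff] at hf
  rw [← hf, map_mul, mul_div_cancel_right₀ _ hq]

lemma isHomogeneousRat_div {p q : MvPolynomial ι ℂ} (hq0 : q ≠ 0) {d : ℕ}
    (hp : p.IsHomogeneous d) (hq : q.IsHomogeneous d) :
    IsHomogeneousRat b (algebraMap _ (RatFun ι) p / algebraMap _ (RatFun ι) q) 0 := by
  classical
  cases nonempty_fintype ι
  rintro t ht v _ ⟨p', q', hv, heq, rfl⟩
  -- A fraction `p' / q'` defining `h` at `v` is carried by the dilation to one defining it at `t • v`.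
  set S : MvPolynomial ι ℂ →ₐ[ℂ] MvPolynomial ι ℂ := pullback b (t⁻¹ • LinearMap.id) with hS
  have hval : ∀ f, eval (b.equivFun (t • v)) (S f) = eval (b.equivFun v) f := fun f => by
    rw [hS, eval_pullback]
    simp [ht]
  have hSq' : eval (b.equivFun (t • v)) (S q') ≠ 0 := by rwa [hval]
  have hne : ∀ {f : MvPolynomial ι ℂ}, f ≠ 0 → algebraMap _ (RatFun ι) f ≠ 0 := fun hf h0 =>
    hf ((FaithfulSMul.algebraMap_eq_zero_iff _ _).mp h0)
  have hq'0 : q' ≠ 0 := by rintro rfl; simp at hv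
  have hSq'0 : S q' ≠ 0 := fun h0 => hSq' (by rw [h0, map_zero])
  have hhom : ∀ {f : MvPolynomial ι ℂ}, f.IsHomogeneous d → S f = C (t⁻¹ ^ d) * f := by
    intro f hf
    ext m
    rw [hS, coeff_pullback_smul_id, coeff_C_mul]
    by_cases hm : coeff m f = 0
    · simp [hm]
    · have := hf hm
      rw [weight_one_eq_degree] at this
      rw [this]
  rw [div_eq_div_iff (hne hq0) (hne hq'0), ← map_mul, ← map_mul,
    (FaithfulSMul.algebraMap_injective _ (RatFun ι)).eq_iff] at heq
  have hcross : p * S q' = S p' * q := by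
    have h1 := congrArg S heq
    rw [map_mul, map_mul, hhom hp, hhom hq] at h1
    have hC : (C (t⁻¹ ^ d) : MvPolynomial ι ℂ) ≠ 0 := by simp [ht]
    refine mul_left_cancel₀ hC ?_
    linear_combination h1
  refine ⟨S p', S q', hSq', ?_, ?_⟩
  · rw [div_eq_div_iff (hne hq0) (hne hSq'0), ← map_mul, ← map_mul, hcross]
  · rw [hval, hval, zpow_zero, one_mul]

end Values

/-! ### Regular functions on the group -/

section Regular

variable {n : ℕ} {G : Subgroup (GL (Fin n) ℂ)}

lemma isRegular_const (a : ℂ) : IsRegular G fun _ => a :=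
  ⟨C a, 0, by simp⟩

lemma IsRegular.mul {φ ψ : G → ℂ} (hφ : IsRegular G φ) (hψ : IsRegular G ψ) :
    IsRegular G fun g => φ g * ψ g := by
  obtain ⟨P, k, hP⟩ := hφ
  obtain ⟨Q, l, hQ⟩ := hψ
  exact ⟨P * Q, k + l, fun g => by
    simp only [hP, hQ, map_mul, pow_add, div_mul_div_comm]⟩

lemma IsRegular.add {φ ψ : G → ℂ} (hφ : IsRegular G φ) (hψ : IsRegular G ψ) :
    IsRegular G fun g => φ g + ψ g := by
  obtain ⟨P, k, hP⟩ := hφ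
  obtain ⟨Q, l, hQ⟩ := hψ
  let D : MvPolynomial (Fin n × Fin n) ℂ := (Matrix.of fun i j => X (i, j)).det
  have hD : ∀ g : GL (Fin n) ℂ, eval (entries g) D = (g : Matrix (Fin n) (Fin n) ℂ).det := by
    intro g
    rw [RingHom.map_det]
    congr 1
    ext i j
    simp [entries]
  refine ⟨P * D ^ l + D ^ k * Q, k + l, fun g => ?_⟩
  have hg : ((g : GL (Fin n) ℂ) : Matrix (Fin n) (Fin n) ℂ).det ≠ 0 :=
    ((Matrix.isUnit_iff_isUnit_det _).mp (g : GL (Fin n) ℂ).isUnit).ne_zero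
  simp only [hP, hQ]
  rw [map_add, map_mul, map_mul, map_pow, map_pow, hD, pow_add,
    div_add_div _ _ (pow_ne_zero _ hg) (pow_ne_zero _ hg)]

lemma isRegular_eval {ι : Type*} {F : G → ι → ℂ} (hF : ∀ i, IsRegular G fun g => F g i)
    (p : MvPolynomial ι ℂ) : IsRegular G fun g => eval (F g) p := by
  induction p using MvPolynomial.induction_on with
  | C a => simpa using isRegular_const a
  | add p q hp hq => simpa using hp.add hq
  | mul_X p i hp => simpa using hp.mul (hF i)

end Regular

/-! ### Invariance under the group -/

section Invariance

variable {n : ℕ} {ι V : Type*} [AddCommGroup V] [Module ℂ V]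

/-- A nonempty Zariski open set is Zariski dense. -/
lemma eq_zero_of_eval_eq_zero_on_isOpen [Finite ι] {b : Module.Basis ι ℂ V} {Ω : Set V}
    (hΩ : IsOpen[zariskiSpace b] Ω) (hne : Ω.Nonempty) {p : MvPolynomial ι ℂ}
    (hp : ∀ v ∈ Ω, eval (b.equivFun v) p = 0) : p = 0 := by
  classical
  cases nonempty_fintype ι
  obtain ⟨U, hU, rfl⟩ := hΩ
  obtain ⟨S, hS⟩ : ∃ S : Set (MvPolynomial ι ℂ), Uᶜ = {x | ∀ r ∈ S, eval x r = 0} := hU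
  have hmem : ∀ x, x ∉ U ↔ ∀ r ∈ S, eval x r = 0 := fun x => by
    rw [← Set.mem_compl_iff, hS]; rfl
  obtain ⟨v₀, hv₀⟩ := hne
  obtain ⟨r, hrS, hr⟩ : ∃ r ∈ S, eval (b.equivFun v₀) r ≠ 0 := by
    by_contra! hcon
    exact (hmem _).mpr hcon hv₀
  have hmul : r * p = 0 := eq_of_eval_equivFun_eq b fun v => by
    rw [map_mul, map_zero]
    by_cases hv : b.equivFun v ∈ U
    · rw [hp v hv, mul_zero]
    · rw [(hmem _).mp hv r hrS, zero_mul]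
  exact (mul_eq_zero.mp hmul).resolve_left (by rintro rfl; simp at hr)

lemma representation_surjective {G : Subgroup (GL (Fin n) ℂ)} (ρ : Representation ℂ G V) (g : G) :
    Function.Surjective (ρ g) := fun v => ⟨ρ g⁻¹ v, by simp⟩

variable [Fintype ι] [DecidableEq ι]
  {G : Subgroup (GL (Fin n) ℂ)} {ρ : Representation ℂ G V} {b : Module.Basis ι ℂ V} {Ω : Set V}

/-- The equation `h ∘ ρ g = h + Φ g` of rational functions, with denominators cleared. -/
lemma pullback_num_mul_den (hΩ : IsOpen[zariskiSpace b] Ω) (hne : Ω.Nonempty)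
    {p q : MvPolynomial ι ℂ} (hq : q ≠ 0) {Φ : G → ℂ}
    (hΦ : ∀ v ∈ Ω, ∀ (g : G) (c c' : ℂ),
      HasValueAt b (algebraMap _ (RatFun ι) p / algebraMap _ (RatFun ι) q) v c →
      HasValueAt b (algebraMap _ (RatFun ι) p / algebraMap _ (RatFun ι) q) (ρ g v) c' →
      c' - c = Φ g) (g : G) :
    pullback b (ρ g) p * q = (p + C (Φ g) * q) * pullback b (ρ g) q := by
  have hgq := pullback_ne_zero b (representation_surjective ρ g) hq
  -- Multiplying by both denominators makes the identity trivial at the poles of `h` and `h ∘ ρ g`.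
  have hzero : q * pullback b (ρ g) q *
      (pullback b (ρ g) p * q - (p + C (Φ g) * q) * pullback b (ρ g) q) = 0 := by
    refine eq_zero_of_eval_eq_zero_on_isOpen hΩ hne fun v hv => ?_
    simp only [map_mul, map_sub, map_add, eval_C, eval_pullback]
    by_cases h1 : eval (b.equivFun v) q = 0
    · rw [h1, zero_mul, zero_mul]
    by_cases h2 : eval (b.equivFun (ρ g v)) q = 0
    · rw [h2, mul_zero, zero_mul]
    have h3 := hΦ v hv g _ _ (hasValueAt_div p h1) (hasValueAt_div p h2)
    rw [← h3]
    field_simp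
    ring
  exact sub_eq_zero.mp ((mul_eq_zero.mp hzero).resolve_left (mul_ne_zero hq hgq))

/-- The rational function `h (2 • v) - h v` is a `G`-invariant, hence a constant `a`. -/
lemma exists_dilation_identity (hΩ : IsOpen[zariskiSpace b] Ω)
    (horb : ∃ v₀ : V, Ω = Set.range fun g : G => ρ g v₀)
    {p q : MvPolynomial ι ℂ} (hq : q ≠ 0) {Φ : G → ℂ}
    (hΦ : ∀ g, pullback b (ρ g) p * q = (p + C (Φ g) * q) * pullback b (ρ g) q) :
    ∃ a : ℂ, pullback b ((2 : ℂ) • LinearMap.id) p * q =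
      (p + C a * q) * pullback b ((2 : ℂ) • LinearMap.id) q := by
  obtain ⟨v₀, rfl⟩ := horb
  have hne : (Set.range fun g : G => ρ g v₀).Nonempty := Set.range_nonempty _
  have hsurj : Function.Surjective ((2 : ℂ) • LinearMap.id : V →ₗ[ℂ] V) := fun v =>
    ⟨(2 : ℂ)⁻¹ • v, by simp⟩
  -- A base point of the orbit that is a pole neither of `h` nor of its dilate.
  obtain ⟨g₀, hg₀⟩ : ∃ g₀ : G,
      eval (b.equivFun (ρ g₀ v₀)) (pullback b ((2 : ℂ) • LinearMap.id) q * q) ≠ 0 := by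
    by_contra! hcon
    refine mul_ne_zero (pullback_ne_zero b hsurj hq) hq
      (eq_zero_of_eval_eq_zero_on_isOpen hΩ hne ?_)
    rintro _ ⟨g, rfl⟩
    exact hcon g
  set w := ρ g₀ v₀ with hw
  set A := eval (b.equivFun ((2 : ℂ) • w)) p with hA
  set B := eval (b.equivFun ((2 : ℂ) • w)) q with hB
  set P := eval (b.equivFun w) p with hP
  set Q := eval (b.equivFun w) q with hQ
  have hBQ : B * Q ≠ 0 := by
    rw [map_mul, eval_pullback] at hg₀
    exact hg₀
  obtain ⟨a, ha⟩ : ∃ a, a * (B * Q) = A * Q - P * B := ⟨_, div_mul_cancel₀ _ hBQ⟩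
  refine ⟨a, sub_eq_zero.mp
    (eq_zero_of_eval_eq_zero_on_isOpen hΩ hne ?_)⟩
  rintro _ ⟨k, rfl⟩
  obtain ⟨g, rfl⟩ : ∃ g, k = g * g₀ := ⟨k * g₀⁻¹, by group⟩
  have h1 := congrArg (eval (b.equivFun ((2 : ℂ) • w))) (hΦ g)
  have h2 := congrArg (eval (b.equivFun w)) (hΦ g)
  simp only [map_mul, map_add, eval_C, eval_pullback, ← hA, ← hB, ← hP, ← hQ, map_smul (ρ g)]
    at h1 h2
  simp only [map_mul, map_sub, map_add, eval_C, eval_pullback, Module.End.mul_apply, ← hw,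
    LinearMap.smul_apply, LinearMap.id_apply]
  refine (mul_eq_zero.mp ?_).resolve_left hBQ
  linear_combination
    eval (b.equivFun (ρ g w)) q * Q * h1 - eval (b.equivFun ((2 : ℂ) • ρ g w)) q * B * h2 -
      eval (b.equivFun (ρ g w)) q * eval (b.equivFun ((2 : ℂ) • ρ g w)) q * ha

/-- A nonzero polynomial that every element of the group multiplies by a nonzero scalar is a
relative invariant: the scalars form a character, which is regular because it can be read off at
any point where the polynomial does not vanish. -/
lemma isRelativeInvariant_of_pullback_eq (hρ : IsRationalRep G ρ) {q : MvPolynomial ι ℂ}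
    (hq : q ≠ 0) (hc : ∀ g, ∃ c : ℂ, c ≠ 0 ∧ pullback b (ρ g) q = C c * q) :
    IsRelativeInvariant G ρ b Ω (algebraMap _ (RatFun ι) q) := by
  choose c hc0 hc using hc
  have hval : ∀ g v, eval (b.equivFun (ρ g v)) q = c g * eval (b.equivFun v) q := fun g v => by
    rw [← eval_pullback, hc, map_mul, eval_C]
  obtain ⟨v₀, hv₀⟩ := exists_eval_equivFun_ne_zero b hq
  let χ : G →* ℂˣ := MonoidHom.mk' (fun g => Units.mk0 (c g) (hc0 g)) fun g k => by
    ext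
    refine mul_right_cancel₀ hv₀ ?_
    simp only [Units.val_mk0, Units.val_mul]
    rw [← hval, map_mul, Module.End.mul_apply, hval, hval, mul_assoc]
  refine ⟨fun h0 => hq ((FaithfulSMul.algebraMap_eq_zero_iff _ _).mp h0), χ, ?_, ?_⟩
  · have hreg : IsRegular G fun g => eval (b.equivFun (ρ g v₀)) q :=
      isRegular_eval (fun i => hρ (b.coord i) v₀) q
    have hχ : (fun g => (χ g : ℂ)) = fun g =>
        eval (b.equivFun (ρ g v₀)) q * (eval (b.equivFun v₀) q)⁻¹ := by
      funext g
      rw [hval, mul_inv_cancel_right₀ hv₀]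
      rfl
    rw [IsRationalCharacter, hχ]
    exact hreg.mul (isRegular_const _)
  · intro v _ g x y hx hy
    rw [hx.eq_eval, hy.eq_eval, hval]
    rfl

end Invariance

end Prehomogeneous

end

theorem mainTheorem5 {n : ℕ} {ι V : Type*} [Finite ι] [AddCommGroup V] [Module ℂ V]
    (G : Subgroup (GL (Fin n) ℂ)) (ρ : Representation ℂ G V) (b : Module.Basis ι ℂ V) (Ω : Set V)
    (hG : Prehomogeneous.IsPrehomogeneous G ρ b Ω)
    (h : Prehomogeneous.RatFun ι)
    (hh : Prehomogeneous.IsAdditiveRelativeInvariant G ρ b Ω h) (h0 : h ≠ 0) :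
    Prehomogeneous.IsHomogeneousRat b h 0 ∧
      ∃ (d : ℕ) (h₁ f₁ : MvPolynomial ι ℂ),
        h₁.IsHomogeneous d ∧ f₁.IsHomogeneous d ∧ IsRelPrime h₁ f₁ ∧
        h = algebraMap _ (Prehomogeneous.RatFun ι) h₁ / algebraMap _ (Prehomogeneous.RatFun ι) f₁ ∧
        Prehomogeneous.IsRelativeInvariant G ρ b Ω
          (algebraMap _ (Prehomogeneous.RatFun ι) f₁) := by
  classical
  cases nonempty_fintype ι
  obtain ⟨Φ, -, hΦ⟩ := hh
  have hne : Ω.Nonempty := by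
    obtain ⟨v₀, rfl⟩ := hG.isOrbit
    exact Set.range_nonempty _
  obtain ⟨p, q, hpq, hq0, rfl⟩ : ∃ p q : MvPolynomial ι ℂ, IsRelPrime p q ∧ q ≠ 0 ∧
      h = algebraMap _ (Prehomogeneous.RatFun ι) p / algebraMap _ (Prehomogeneous.RatFun ι) q :=
    ⟨IsFractionRing.num (MvPolynomial ι ℂ) h, IsFractionRing.den (MvPolynomial ι ℂ) h,
      IsFractionRing.num_den_reduced _ _, nonZeroDivisors.coe_ne_zero _,
      (IsFractionRing.mk'_num_den' _ _).symm⟩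
  have hid := Prehomogeneous.pullback_num_mul_den hG.isOpen hne hq0 hΦ
  obtain ⟨a, ha⟩ := Prehomogeneous.exists_dilation_identity hG.isOpen hG.isOrbit hq0 hid
  obtain ⟨d, hpd, hqd⟩ := Prehomogeneous.isHomogeneous_of_pullback_two b hpq hq0 ha
  refine ⟨Prehomogeneous.isHomogeneousRat_div hq0 hpd hqd, d, p, q, hpd, hqd, hpq, rfl, ?_⟩
  refine Prehomogeneous.isRelativeInvariant_of_pullback_eq hG.rational hq0 fun g => ?_
  obtain ⟨c, hc0, hc, -⟩ := Prehomogeneous.exists_pullback_eq_smul_of_isRelPrime b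
    (Prehomogeneous.representation_surjective ρ g) hpq hq0 (hid g)
  exact ⟨c, hc0, hc⟩
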